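/- **Theorem (Qunity has a well-defined semantics).** Let $\mathbb X$ be a set of variables and let $r$ range over a set of real constants, each denoting a real number (also written $r$). *Syntax.* Data types: $T ::= \mathtt{Void} \mid \mathtt{()} \mid T\oplus T \mid T\otimes T$; $\mathtt{Bit}=\mathtt{()}\oplus\mathtt{()}$. Expressions: $e ::= \mathtt{()} \mid x \mid (e,e) \mid \mathtt{ctrl}_{T,T'}\, e\,\{e_1\mapsto e_1';\dots;e_n\mapsto e_n'\}\ (n\ge 0) \mid \mathtt{try}\ e\ \mathtt{catch}\ e \mid f\,e$. Programs: $f ::= \mathtt{u_3}(r,r,r)\mid \mathtt{left}_{T,T}\mid \mathtt{right}_{T,T}\mid \lambda e\overset{T}{\mapsto}e \mid \mathtt{rphase}_T\{e\mapsto r;\ \mathtt{else}\mapsto r'\}$. Put $\mathtt{gphase}_T(r)=\mathtt{rphase}_T\{y\mapsto r;\mathtt{else}\mapsto r\}$, with $y$ a variable. $FV(e)$ is the set of variables occurring in $e$ outside programs. *Contexts and values.* A context is a finite list $x_1:T_1,\dots,x_n:T_n$; it is well-formed if its variables are distinct; a comma denotes concatenation, $\pi$ a list permutation, $\mathrm{dom}$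 the set of variables. $\mathbb V(T)$ is the set of values of type $T$: $\mathbb V(\mathtt{Void})=\varnothing$, $\mathbb V(\mathtt{()})=\{\mathtt{()}\}$, $\mathbb V(T_0\oplus T_1)=\{\mathtt{left}\,v_0\}\sqcup\{\mathtt{right}\,v_1\}$, $\mathbb V(T_0\otimes T_1)=\{(v_0,v_1)\}$ with $v_i\in\mathbb V(T_i)$. $\mathbb V(x_1:T_1,\dots)$ is the set of lists $x_1\mapsto v_1,\dots$ with $v_i\in\mathbb V(T_i)$. $\mathcal H(T)$, $\mathcal H(\Delta)$ are the Hilbert spaces with orthonormal bases $|v\rangle$, $v\in\mathbb V(T)$, and $|\tau\rangle$, $\tau\in\mathbb V(\Delta)$, so that $\oplus,\otimes$ become direct sum and tensor product. *Auxiliary judgments.* $\mathrm{spanning}_T(e_1,\dots,e_n)$ is generated by: $\mathrm{spanning}_{\mathtt{Void}}()$; $\mathrm{spanning}_{\mathtt{()}}(\mathtt{()})$; $\mathrm{spanning}_T(x)$; if $\mathrm{spanning}_T(\vec e)$ and $\mathrm{spanning}_{T'}(\vec e\,')$ then $\mathrm{spanning}_{T\oplus T'}$ of the list of all $\mathtt{left}_{T,T'}\,e_i$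 followed by all $\mathtt{right}_{T,T'}\,e_j'$; if $\mathrm{spanning}_T(e_1,\dots,e_m)$ and, for each $j$, $\mathrm{spanning}_{T'}(e'_{j,1},\dots,e'_{j,n_j})$ with $FV(e_j)\cap FV(e'_{j,k})=\varnothing$ for all $k$, then $\mathrm{spanning}_{T\otimes T'}$ of the list of all $(e_j,e'_{j,k})$; closure under permutation of the list. $\mathrm{ortho}_T(\vec e)$ holds iff $\vec e$ is a subsequence of a list that is spanning for $T$. $\mathrm{erases}_T(x;e_1,\dots,e_n)$ is generated by: $\mathrm{erases}_T(x;x,\dots,x)$ ($n\ge0$ copies); an entry $e_j$ may be replaced by $\mathtt{gphase}_T(r)\,e_j$; consecutive entries $e_{j,1},\dots,e_{j,m}$ may be replaced by one entry $\mathtt{ctrl}_{T',T}\,e\,\{e_1'\mapsto e_{j,1};\dots;e_m'\mapsto e_{j,m}\}$; and $\mathrm{erases}_{T_0}(x;e_{0,1},\dots,e_{0,n})$, or $\mathrm{erases}_{T_1}(x;e_{1,1},\dots,e_{1,n})$, yields $\mathrm{erases}_{T_0\otimes T_1}(x;(e_{0,1},e_{1,1}),\dots,(e_{0,n},e_{1,n}))$.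 *Typing.* There are four judgments: pure expressions $\Gamma\mid\Delta\vdash e:T$, mixed expressions $\Delta\Vdash e:T$, pure programs $\vdash f:T\rightsquigarrow T'$, mixed programs $\vdash f:T\Rrightarrow T'$. All contexts are well-formed, and in $\Gamma\mid\Delta$ no variable is in both $\Gamma$ and $\Delta$. With each rule we give the denotation $[\![\cdot]\!]$ of its conclusion in terms of those of its premises; formulas on basis elements are extended linearly. For $\sigma\in\mathbb V(\Gamma)$, $[\![\sigma:\Gamma\mid\Delta\vdash e:T]\!]\in\mathcal L(\mathcal H(\Delta),\mathcal H(T))$ is abbreviated $[\![e]\!]_\sigma$, and $[\![e]\!]$ if $\Gamma=\varnothing$; $[\![\Delta\Vdash e:T]\!]\in\mathcal L(\mathcal L(\mathcal H(\Delta)),\mathcal L(\mathcal H(T)))$ is abbreviated $[\![e]\!]^{\Vdash}$; $[\![f]\!]\in\mathcal L(\mathcal H(T),\mathcal H(T'))$ and $[\![f]\!]^{\Rrightarrow}\in\mathcal L(\mathcal L(\mathcal H(T)),\mathcal L(\mathcal H(T')))$ are the denotations of programs. Pure expressions: - $\Gamma\mid\varnothing\vdash\mathtt{()}:\mathtt{()}$,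 with $|\varnothing\rangle\mapsto|\mathtt{()}\rangle$. - $\Gamma,x:T,\Gamma'\mid\varnothing\vdash x:T$, with $|\varnothing\rangle\mapsto|\sigma(x)\rangle$. - $\Gamma\mid x:T\vdash x:T$ if $x\notin\mathrm{dom}(\Gamma)$, with $|x\mapsto v\rangle\mapsto|v\rangle$. - From $\Gamma\mid\Delta,\Delta_0\vdash e_0:T_0$ and $\Gamma\mid\Delta,\Delta_1\vdash e_1:T_1$ infer $\Gamma\mid\Delta,\Delta_0,\Delta_1\vdash(e_0,e_1):T_0\otimes T_1$, with $|\tau,\tau_0,\tau_1\rangle\mapsto[\![e_0]\!]_\sigma|\tau,\tau_0\rangle\otimes[\![e_1]\!]_\sigma|\tau,\tau_1\rangle$. - From $\Gamma,\Delta\Vdash e:T$; $\mathrm{ortho}_T(e_1,\dots,e_n)$; $\varnothing\mid\Gamma_j\vdash e_j:T$ for all $j$; $\mathrm{erases}_{T'}(x;e_1',\dots,e_n')$ for all $x\in\mathrm{dom}(\Delta)$; $\Gamma,\Gamma',\Gamma_j\mid\Delta,\Delta'\vdash e_j':T'$ for all $j$; and $\Delta'=\varnothing$ if $n=0$; infer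 $\Gamma,\Gamma'\mid\Delta,\Delta'\vdash\mathtt{ctrl}_{T,T'}\,e\,\{e_j\mapsto e_j'\}_{j=1}^n:T'$, with, for the valuation $\sigma,\sigma'$, $$|\tau,\tau'\rangle\mapsto\sum_{v\in\mathbb V(T)}\langle v|[\![e]\!]^{\Vdash}\big(|\sigma,\tau\rangle\langle\sigma,\tau|\big)|v\rangle\sum_{j=1}^n\sum_{\sigma_j\in\mathbb V(\Gamma_j)}\langle\sigma_j|[\![e_j]\!]^\dagger|v\rangle\,[\![e_j']\!]_{\sigma,\sigma',\sigma_j}|\tau,\tau'\rangle .$$ - From $\vdash f:T\rightsquigarrow T'$ and $\Gamma\mid\Delta\vdash e:T$ infer $\Gamma\mid\Delta\vdash f\,e:T'$, with $[\![f]\!]\,[\![e]\!]_\sigma$. - From $\Gamma\mid\Delta\vdash e:T$ infer $\pi_g(\Gamma)\mid\pi_d(\Delta)\vdash e:T$, with, for the valuation $\pi_g(\sigma)$, $|\pi_d(\tau)\rangle\mapsto[\![e]\!]_\sigma|\tau\rangle$. Mixed expressions: - From $\varnothing\mid\Delta\vdash e:T$ infer $\Delta\Vdash e:T$, with $|\tau\rangle\langle\tau'|\mapsto[\![e]\!]\,|\tau\rangle\langle\tau'|\,[\![e]\!]^\dagger$.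 - From $\Delta\Vdash e:T$ infer $\pi(\Delta)\Vdash e:T$, with $|\pi(\tau)\rangle\langle\pi(\tau')|\mapsto[\![e]\!]^{\Vdash}(|\tau\rangle\langle\tau'|)$. - From $\Delta,\Delta_0\Vdash e_0:T_0$ and $\Delta,\Delta_1\Vdash e_1:T_1$ infer $\Delta,\Delta_0,\Delta_1\Vdash(e_0,e_1):T_0\otimes T_1$, with $|\tau,\tau_0,\tau_1\rangle\langle\tau',\tau_0',\tau_1'|\mapsto[\![e_0]\!]^{\Vdash}(|\tau,\tau_0\rangle\langle\tau',\tau_0'|)\otimes[\![e_1]\!]^{\Vdash}(|\tau,\tau_1\rangle\langle\tau',\tau_1'|)$. - From $\Delta_0\Vdash e_0:T$ and $\Delta_1\Vdash e_1:T$ infer $\Delta_0,\Delta_1\Vdash\mathtt{try}\ e_0\ \mathtt{catch}\ e_1:T$, with $|\tau_0,\tau_1\rangle\langle\tau_0',\tau_1'|\mapsto[\![e_0]\!]^{\Vdash}(|\tau_0\rangle\langle\tau_0'|)+\big(1-\mathrm{tr}\,[\![e_0]\!]^{\Vdash}(|\tau_0\rangle\langle\tau_0'|)\big)\,[\![e_1]\!]^{\Vdash}(|\tau_1\rangle\langle\tau_1'|)$.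 - From $\vdash f:T\Rrightarrow T'$ and $\Delta\Vdash e:T$ infer $\Delta\Vdash f\,e:T'$, with $[\![f]\!]^{\Rrightarrow}\circ[\![e]\!]^{\Vdash}$. Pure programs: - $\vdash\mathtt{u_3}(\theta,\phi,\lambda):\mathtt{Bit}\rightsquigarrow\mathtt{Bit}$, with, writing $|0\rangle=|\mathtt{left}\,\mathtt{()}\rangle$ and $|1\rangle=|\mathtt{right}\,\mathtt{()}\rangle$, $|0\rangle\mapsto\cos(\theta/2)|0\rangle+e^{i\phi}\sin(\theta/2)|1\rangle$ and $|1\rangle\mapsto-e^{i\lambda}\sin(\theta/2)|0\rangle+e^{i(\phi+\lambda)}\cos(\theta/2)|1\rangle$. - $\vdash\mathtt{left}_{T_0,T_1}:T_0\rightsquigarrow T_0\oplus T_1$ and $\vdash\mathtt{right}_{T_0,T_1}:T_1\rightsquigarrow T_0\oplus T_1$, with $|v\rangle\mapsto|\mathtt{left}\,v\rangle$ and $|v\rangle\mapsto|\mathtt{right}\,v\rangle$. - From $\varnothing\mid\Delta\vdash e:T$ and $\varnothing\mid\Delta\vdash e':T'$ infer $\vdash\lambda e\overset{T}{\mapsto}e':T\rightsquigarrow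 T'$, with $[\![e']\!]\,[\![e]\!]^\dagger$. - From $\varnothing\mid\Delta\vdash e:T$ infer $\vdash\mathtt{rphase}_T\{e\mapsto r;\mathtt{else}\mapsto r'\}:T\rightsquigarrow T$, with $e^{ir}[\![e]\!][\![e]\!]^\dagger+e^{ir'}(\mathbb I-[\![e]\!][\![e]\!]^\dagger)$. Mixed programs: - From $\vdash f:T\rightsquigarrow T'$ infer $\vdash f:T\Rrightarrow T'$, with $|v\rangle\langle v'|\mapsto[\![f]\!]\,|v\rangle\langle v'|\,[\![f]\!]^\dagger$. - From $\varnothing\mid\Delta,\Delta_0\vdash e:T$ and $\Delta\Vdash e':T'$ infer $\vdash\lambda e\overset{T}{\mapsto}e':T\Rrightarrow T'$, with $|v\rangle\langle v'|\mapsto[\![e']\!]^{\Vdash}\big(\mathrm{tr}_{\Delta_0}([\![e]\!]^\dagger|v\rangle\langle v'|[\![e]\!])\big)$. These clauses define a denotation for every derivation (proof tree) of a typing judgment, by recursion on the derivation. A judgment is valid if it has a derivation. Then: - whenever $\Gamma\mid\Delta\vdash e:T$ is valid and $\sigma\in\mathbb V(\Gamma)$, the denotation $[\![\sigma:\Gamma\mid\Delta\vdash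 e:T]\!]$ is uniquely defined; - whenever $\Delta\Vdash e:T$ is valid, the denotation $[\![\Delta\Vdash e:T]\!]$ is uniquely defined; - whenever $\vdash f:T\rightsquigarrow T'$ is valid, the denotation $[\![\vdash f:T\rightsquigarrow T']\!]$ is uniquely defined; - whenever $\vdash f:T\Rrightarrow T'$ is valid, the denotation $[\![\vdash f:T\Rrightarrow T']\!]$ is uniquely defined; that is, in each case there is exactly one operator (superoperator) which is the denotation of every derivation of the judgment. -/

import Mathlib

noncomputable section

namespace Qunity

universe u v

/-! ## Types, values, syntax -/

/-- Data types of Qunity. -/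
inductive Ty : Type
  | void : Ty
  | unit : Ty
  | sum : Ty → Ty → Ty
  | prod : Ty → Ty → Ty

/-- `Bit = () ⊕ ()`. -/
def Ty.bit : Ty := .sum .unit .unit

/-- The set `𝕍(T)` of values of type `T`: no value of `Void`, the value `()`, the tagged values
`left v₀` and `right v₁`, and the pairs `(v₀, v₁)`. -/
def Ty.Val : Ty → Type
  | .void => Empty
  | .unit => Unit
  | .sum T₀ T₁ => T₀.Val ⊕ T₁.Val
  | .prod T₀ T₁ => T₀.Val × T₁.Val

instance Ty.instDecidableEqVal : (T : Ty) → DecidableEq T.Val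
  | .void => inferInstanceAs (DecidableEq Empty)
  | .unit => inferInstanceAs (DecidableEq Unit)
  | .sum T₀ T₁ =>
    letI := Ty.instDecidableEqVal T₀
    letI := Ty.instDecidableEqVal T₁
    inferInstanceAs (DecidableEq (T₀.Val ⊕ T₁.Val))
  | .prod T₀ T₁ =>
    letI := Ty.instDecidableEqVal T₀
    letI := Ty.instDecidableEqVal T₁
    inferInstanceAs (DecidableEq (T₀.Val × T₁.Val))

instance Ty.instFintypeVal : (T : Ty) → Fintype T.Val
  | .void => inferInstanceAs (Fintype Empty)
  | .unit => inferInstanceAs (Fintype Unit)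
  | .sum T₀ T₁ =>
    letI := Ty.instFintypeVal T₀
    letI := Ty.instFintypeVal T₁
    inferInstanceAs (Fintype (T₀.Val ⊕ T₁.Val))
  | .prod T₀ T₁ =>
    letI := Ty.instFintypeVal T₀
    letI := Ty.instFintypeVal T₁
    inferInstanceAs (Fintype (T₀.Val × T₁.Val))

mutual

/-- Expressions, over variables `X` and real constants `R`.
`ctrl e T n p b T'` is `ctrl e {p 0 ↦ b 0; …; p (n-1) ↦ b (n-1)}` with annotations `T`, `T'`. -/
inductive Expr (X : Type u) (R : Type v) : Type (max u v)
  | unit : Expr X R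
  | var (x : X) : Expr X R
  | pair (e₀ e₁ : Expr X R) : Expr X R
  | ctrl (e : Expr X R) (T : Ty) (n : ℕ) (p b : Fin n → Expr X R) (T' : Ty) : Expr X R
  | tryCatch (e₀ e₁ : Expr X R) : Expr X R
  | app (f : Prog X R) (e : Expr X R) : Expr X R

/-- Programs. `abs e T e'` is `λ e ↦ e'` with annotation `T`, and `rphase T e r r'` is the relative
phase construct. -/
inductive Prog (X : Type u) (R : Type v) : Type (max u v)
  | u3 (rθ rφ rlam : R) : Prog X R
  | left (T₀ T₁ : Ty) : Prog X R
  | right (T₀ T₁ : Ty) : Prog X R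
  | abs (e : Expr X R) (T : Ty) (e' : Expr X R) : Prog X R
  | rphase (T : Ty) (e : Expr X R) (r r' : R) : Prog X R

end

variable {X : Type u} {R : Type v}

/-- The variables of an expression (expressions have no binders, programs are closed). -/
def Expr.FV : Expr X R → Set X
  | .unit => ∅
  | .var x => {x}
  | .pair e₀ e₁ => e₀.FV ∪ e₁.FV
  | .ctrl e _ _ p b _ => e.FV ∪ (⋃ j, (p j).FV) ∪ ⋃ j, (b j).FV
  | .tryCatch e₀ e₁ => e₀.FV ∪ e₁.FV
  | .app _ e => e.FV

/-! ## Contexts and valuations -/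

/-- A typing context: a list of variable-type pairs. -/
abbrev Ctx (X : Type u) : Type u := List (X × Ty)

/-- The variables bound by a context, in order. -/
def dom (Γ : Ctx X) : List X := Γ.map Prod.fst

/-- A context is well-formed if its variables are distinct. -/
def WF (Γ : Ctx X) : Prop := (dom Γ).Nodup

/-- The set `𝕍(Γ)` of valuations of a context: the lists of values, one for each binding. -/
def CVal : Ctx X → Type
  | [] => Unit
  | b :: Γ => b.2.Val × CVal Γ

instance CVal.instDecidableEq : (Γ : Ctx X) → DecidableEq (CVal Γ)
  | [] => inferInstanceAs (DecidableEq Unit)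
  | b :: Γ =>
    letI := CVal.instDecidableEq Γ
    inferInstanceAs (DecidableEq (b.2.Val × CVal Γ))

instance CVal.instFintype : (Γ : Ctx X) → Fintype (CVal Γ)
  | [] => inferInstanceAs (Fintype Unit)
  | b :: Γ =>
    letI := CVal.instFintype Γ
    inferInstanceAs (Fintype (b.2.Val × CVal Γ))

/-- The empty valuation. -/
def CVal.nil : CVal ([] : Ctx X) := ()

/-- Concatenation `σ, τ` of valuations. -/
def CVal.append : {Γ Δ : Ctx X} → CVal Γ → CVal Δ → CVal (Γ ++ Δ)
  | [], _, _, τ => τ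
  | _ :: _, _, σ, τ => (σ.1, CVal.append σ.2 τ)

/-- The part `σ` of a concatenated valuation `σ, τ`. -/
def CVal.fst : {Γ Δ : Ctx X} → CVal (Γ ++ Δ) → CVal Γ
  | [], _, _ => ()
  | _ :: _, _, σ => (σ.1, CVal.fst σ.2)

/-- The part `τ` of a concatenated valuation `σ, τ`. -/
def CVal.snd : {Γ Δ : Ctx X} → CVal (Γ ++ Δ) → CVal Δ
  | [], _, τ => τ
  | _ :: _, _, σ => CVal.snd σ.2

/-- List permutation functions on contexts: an element of `CtxPerm Γ Γ'` is a permutation `π`, given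
as a composite of adjacent transpositions, with `π(Γ) = Γ'`. -/
inductive CtxPerm : Ctx X → Ctx X → Type u
  | nil : CtxPerm [] []
  | cons (b : X × Ty) {Γ Γ' : Ctx X} (π : CtxPerm Γ Γ') : CtxPerm (b :: Γ) (b :: Γ')
  | swap (a b : X × Ty) (Γ : Ctx X) : CtxPerm (a :: b :: Γ) (b :: a :: Γ)
  | trans {Γ₁ Γ₂ Γ₃ : Ctx X} (π : CtxPerm Γ₁ Γ₂) (π' : CtxPerm Γ₂ Γ₃) : CtxPerm Γ₁ Γ₃

/-- The action `σ ↦ π(σ)` of a list permutation on valuations. -/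
def CtxPerm.act : {Γ Γ' : Ctx X} → CtxPerm Γ Γ' → (CVal Γ ≃ CVal Γ')
  | _, _, .nil => Equiv.refl _
  | _, _, .cons b π => Equiv.prodCongr (Equiv.refl b.2.Val) π.act
  | _, _, .swap _ _ _ =>
    { toFun := fun σ => (σ.2.1, σ.1, σ.2.2)
      invFun := fun σ => (σ.2.1, σ.1, σ.2.2)
      left_inv := fun _ => rfl
      right_inv := fun _ => rfl }
  | _, _, .trans π π' => π.act.trans π'.act

/-! ## The auxiliary judgments: spanning, orthogonality, erasure -/

/-- `spanning T [e₁, …, eₙ]`. In `pair`, a row `(e, [e'₁, …, e'ₖ])` lists an expression together with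
the expressions it is paired with. -/
inductive Spanning : Ty → List (Expr X R) → Prop
  | void : Spanning .void []
  | unit : Spanning .unit [.unit]
  | var (T : Ty) (x : X) : Spanning T [.var x]
  | sum {T T' : Ty} {es es' : List (Expr X R)} (h : Spanning T es) (h' : Spanning T' es') :
      Spanning (.sum T T') (es.map (.app (.left T T')) ++ es'.map (.app (.right T T')))
  | pair {T T' : Ty} {rows : List (Expr X R × List (Expr X R))}
      (h : Spanning T (rows.map Prod.fst))
      (h' : ∀ row ∈ rows, Spanning T' row.2)
      (hFV : ∀ row ∈ rows, ∀ e' ∈ row.2, Disjoint row.1.FV e'.FV) :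
      Spanning (.prod T T') (rows.flatMap fun row => row.2.map (.pair row.1))
  | perm {T : Ty} {es es' : List (Expr X R)} (h : Spanning T es) (hp : es.Perm es') :
      Spanning T es'

/-- `ortho T [e₁, …, eₙ]`: the list is a subsequence of a spanning list. -/
def Ortho (T : Ty) (es : List (Expr X R)) : Prop :=
  ∃ es' : List (Expr X R), Spanning T es' ∧ es.Sublist es'

/-- `gphase_T(r) = rphase_T {y ↦ r; else r}`, where `y` is a variable. -/
def Prog.gphase (T : Ty) (y : X) (r : R) : Prog X R := .rphase T (.var y) r r

/-- `erases_T (x; e₁, …, eₙ)`. -/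
inductive Erases (x : X) : Ty → List (Expr X R) → Prop
  | gphase {T : Ty} {l l' : List (Expr X R)} {e : Expr X R} (y : X) (r : R)
      (h : Erases x T (l ++ e :: l')) :
      Erases x T (l ++ .app (.gphase T y r) e :: l')
  | ctrl {T T' : Ty} {l l' : List (Expr X R)} {e : Expr X R} {m : ℕ} {p b : Fin m → Expr X R}
      (h : Erases x T (l ++ List.ofFn b ++ l')) :
      Erases x T (l ++ .ctrl e T' m p b T :: l')
  | var (T : Ty) (n : ℕ) : Erases x T (List.replicate n (.var x))
  | pair0 {T₀ T₁ : Ty} {es : List (Expr X R × Expr X R)} (h : Erases x T₀ (es.map Prod.fst)) :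
      Erases x (.prod T₀ T₁) (es.map fun q => .pair q.1 q.2)
  | pair1 {T₀ T₁ : Ty} {es : List (Expr X R × Expr X R)} (h : Erases x T₁ (es.map Prod.snd)) :
      Erases x (.prod T₀ T₁) (es.map fun q => .pair q.1 q.2)

/-! ## Typing derivations

The four types below are the types of proofs (derivation trees) of the four typing judgments; a
judgment is valid if its type of proofs is nonempty. Contexts occurring in a judgment are
well-formed, and a variable is not both classical and quantum; `WF` premises are written in the
rules where this is not inherited from the premises. -/

mutual

/-- Proofs of the pure expression typing judgment `Γ ∣ Δ ⊢ e : T`. -/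
inductive PureExp {X : Type u} {R : Type v} : Ctx X → Ctx X → Expr X R → Ty → Type (max u v)
  | unit {Γ : Ctx X} (wf : WF Γ) : PureExp Γ [] .unit .unit
  | cvar {Γ Γ' : Ctx X} {x : X} {T : Ty} (wf : WF (Γ ++ (x, T) :: Γ')) :
      PureExp (Γ ++ (x, T) :: Γ') [] (.var x) T
  | qvar {Γ : Ctx X} {x : X} {T : Ty} (wf : WF Γ) (hx : x ∉ dom Γ) :
      PureExp Γ [(x, T)] (.var x) T
  | pair {Γ Δ Δ₀ Δ₁ : Ctx X} {e₀ e₁ : Expr X R} {T₀ T₁ : Ty}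
      (wf : WF (Δ ++ Δ₀ ++ Δ₁))
      (d₀ : PureExp Γ (Δ ++ Δ₀) e₀ T₀) (d₁ : PureExp Γ (Δ ++ Δ₁) e₁ T₁) :
      PureExp Γ (Δ ++ Δ₀ ++ Δ₁) (.pair e₀ e₁) (.prod T₀ T₁)
  /- `relevant` is automatic for `n ≥ 1` branches, where `Δ'` is used by every branch; for `n = 0` it
  says that a quantum variable has to be used by the expression. -/
  | ctrl {Γ Γ' Δ Δ' : Ctx X} {e : Expr X R} {T T' : Ty} {n : ℕ} {p b : Fin n → Expr X R}
      {Γp : Fin n → Ctx X}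
      (wf : WF ((Γ ++ Γ') ++ (Δ ++ Δ')))
      (relevant : n = 0 → Δ' = [])
      (d : MixExp (Γ ++ Δ) e T)
      (ortho : Ortho T (List.ofFn p))
      (dp : ∀ j, PureExp [] (Γp j) (p j) T)
      (erases : ∀ x ∈ dom Δ, Erases x T' (List.ofFn b))
      (db : ∀ j, PureExp (Γ ++ Γ' ++ Γp j) (Δ ++ Δ') (b j) T') :
      PureExp (Γ ++ Γ') (Δ ++ Δ') (.ctrl e T n p b T') T'
  | app {Γ Δ : Ctx X} {f : Prog X R} {e : Expr X R} {T T' : Ty}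
      (df : PureProg f T T') (d : PureExp Γ Δ e T) : PureExp Γ Δ (.app f e) T'
  | perm {Γ Γ' Δ Δ' : Ctx X} {e : Expr X R} {T : Ty}
      (πg : CtxPerm Γ Γ') (πd : CtxPerm Δ Δ') (d : PureExp Γ Δ e T) : PureExp Γ' Δ' e T

/-- Proofs of the mixed expression typing judgment `Δ ⊩ e : T`. -/
inductive MixExp {X : Type u} {R : Type v} : Ctx X → Expr X R → Ty → Type (max u v)
  | mix {Δ : Ctx X} {e : Expr X R} {T : Ty} (d : PureExp [] Δ e T) : MixExp Δ e T
  | perm {Δ Δ' : Ctx X} {e : Expr X R} {T : Ty} (π : CtxPerm Δ Δ') (d : MixExp Δ e T) :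
      MixExp Δ' e T
  | pair {Δ Δ₀ Δ₁ : Ctx X} {e₀ e₁ : Expr X R} {T₀ T₁ : Ty}
      (wf : WF (Δ ++ Δ₀ ++ Δ₁))
      (d₀ : MixExp (Δ ++ Δ₀) e₀ T₀) (d₁ : MixExp (Δ ++ Δ₁) e₁ T₁) :
      MixExp (Δ ++ Δ₀ ++ Δ₁) (.pair e₀ e₁) (.prod T₀ T₁)
  | tryCatch {Δ₀ Δ₁ : Ctx X} {e₀ e₁ : Expr X R} {T : Ty}
      (wf : WF (Δ₀ ++ Δ₁)) (d₀ : MixExp Δ₀ e₀ T) (d₁ : MixExp Δ₁ e₁ T) :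
      MixExp (Δ₀ ++ Δ₁) (.tryCatch e₀ e₁) T
  | app {Δ : Ctx X} {f : Prog X R} {e : Expr X R} {T T' : Ty}
      (df : MixProg f T T') (d : MixExp Δ e T) : MixExp Δ (.app f e) T'

/-- Proofs of the pure program typing judgment `⊢ f : T ⇝ T'`. -/
inductive PureProg {X : Type u} {R : Type v} : Prog X R → Ty → Ty → Type (max u v)
  | gate (rθ rφ rlam : R) : PureProg (.u3 rθ rφ rlam) .bit .bit
  | left (T₀ T₁ : Ty) : PureProg (.left T₀ T₁) T₀ (.sum T₀ T₁)
  | right (T₀ T₁ : Ty) : PureProg (.right T₀ T₁) T₁ (.sum T₀ T₁)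
  | abs {Δ : Ctx X} {e e' : Expr X R} {T T' : Ty}
      (d : PureExp [] Δ e T) (d' : PureExp [] Δ e' T') : PureProg (.abs e T e') T T'
  | rphase {Δ : Ctx X} {e : Expr X R} {T : Ty} (r r' : R)
      (d : PureExp [] Δ e T) : PureProg (.rphase T e r r') T T

/-- Proofs of the mixed program typing judgment `⊢ f : T ⇛ T'`. -/
inductive MixProg {X : Type u} {R : Type v} : Prog X R → Ty → Ty → Type (max u v)
  | channel {f : Prog X R} {T T' : Ty} (d : PureProg f T T') : MixProg f T T'
  | abs {Δ Δ₀ : Ctx X} {e e' : Expr X R} {T T' : Ty}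
      (d : PureExp [] (Δ ++ Δ₀) e T) (d' : MixExp Δ e' T') : MixProg (.abs e T e') T T'

end

/-! ## Operators and superoperators

`ℋ(T)` and `ℋ(Δ)` are the Hilbert spaces with canonical orthonormal bases `|v⟩`, `v ∈ 𝕍(T)`, and
`|τ⟩`, `τ ∈ 𝕍(Δ)`. Linear operators between them are represented by their matrices in these bases,
`A v τ = ⟨v| A |τ⟩`, so that adjoints are conjugate transposes and tensor products are Kronecker
products. -/

/-- `ℒ(ℋ, ℋ')` for the Hilbert spaces with bases indexed by `m` and `n`. -/
abbrev Op (m n : Type) : Type := Matrix n m ℂ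

/-- `ℒ(ℒ(ℋ), ℒ(ℋ'))` for the Hilbert spaces with bases indexed by `m` and `n`. -/
abbrev SuperOp (m n : Type) : Type := Op m m →ₗ[ℂ] Op n n

/-- The operator `|i⟩⟨j|`. -/
def outer {m : Type} [DecidableEq m] (i j : m) : Op m m := Matrix.single i j 1

/-- The superoperator with prescribed values `|i⟩⟨j| ↦ F i j`, extended linearly. -/
def SuperOp.ofBasis {m n : Type} [Fintype m] (F : m → m → Op n n) : SuperOp m n where
  toFun ρ := ∑ i, ∑ j, ρ i j • F i j
  map_add' ρ ρ' := by
    simp only [Matrix.add_apply, add_smul, Finset.sum_add_distrib]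
  map_smul' c ρ := by
    simp only [Matrix.smul_apply, smul_eq_mul, mul_smul, Finset.smul_sum, RingHom.id_apply]

/-- The partial trace over `ℋ(Δ₀)` of an operator on `ℋ(Δ, Δ₀)`. -/
def ptrace {Δ Δ₀ : Ctx X} (ρ : Op (CVal (Δ ++ Δ₀)) (CVal (Δ ++ Δ₀))) : Op (CVal Δ) (CVal Δ) :=
  Matrix.of fun τ τ' => ∑ τ₀ : CVal Δ₀, ρ (τ.append τ₀) (τ'.append τ₀)

/-- The operator of the gate `u₃(θ, φ, λ)`; the basis vectors `|0⟩`, `|1⟩` are the left and the right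
value of type `Bit`. -/
def gateOp (θ φ lam : ℝ) : Op Ty.bit.Val Ty.bit.Val :=
  Matrix.of fun (w v : Unit ⊕ Unit) =>
    match w, v with
    | .inl _, .inl _ => (Real.cos (θ / 2) : ℂ)
    | .inr _, .inl _ => Complex.exp (Complex.I * φ) * Real.sin (θ / 2)
    | .inl _, .inr _ => -(Complex.exp (Complex.I * lam) * Real.sin (θ / 2))
    | .inr _, .inr _ => Complex.exp (Complex.I * (φ + lam)) * Real.cos (θ / 2)

/-- `|v⟩ ↦ |left v⟩`. -/
def leftOp (T₀ T₁ : Ty) : Op T₀.Val (Ty.sum T₀ T₁).Val :=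
  Matrix.of fun (w : T₀.Val ⊕ T₁.Val) v => if w = Sum.inl v then 1 else 0

/-- `|v⟩ ↦ |right v⟩`. -/
def rightOp (T₀ T₁ : Ty) : Op T₁.Val (Ty.sum T₀ T₁).Val :=
  Matrix.of fun (w : T₀.Val ⊕ T₁.Val) v => if w = Sum.inr v then 1 else 0

/-- `A ⊗ B` as an operator on `ℋ(T₀ ⊗ T₁) = ℋ(T₀) ⊗ ℋ(T₁)`. -/
def tensorOp {T₀ T₁ : Ty} (A : Op T₀.Val T₀.Val) (B : Op T₁.Val T₁.Val) :
    Op (Ty.prod T₀ T₁).Val (Ty.prod T₀ T₁).Val :=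
  Matrix.kroneckerMap (· * ·) A B

/-! ## Denotations

The denotation is defined by recursion on proofs. The parameter `re` interprets real constants. -/

mutual

/-- `⟦σ : Γ ∣ Δ ⊢ e : T⟧`, for a proof of the judgment. -/
def PureExp.den (re : R → ℝ) : {Γ Δ : Ctx X} → {e : Expr X R} → {T : Ty} →
    PureExp Γ Δ e T → CVal Γ → Op (CVal Δ) T.Val
  | _, _, _, _, .unit _, _ => Matrix.of fun _ _ => 1
  | _, _, _, _, .cvar (Γ := Γ) _, σ =>
    Matrix.of fun v _ => if v = (CVal.snd (Γ := Γ) σ).1 then 1 else 0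
  | _, _, _, _, .qvar _ _, _ => Matrix.of fun v τ => if v = τ.1 then 1 else 0
  | _, _, _, _, .pair (Δ := Δ) (Δ₀ := Δ₀) (Δ₁ := Δ₁) _ d₀ d₁, σ =>
    Matrix.of fun w τ =>
      let τ' : CVal (Δ ++ Δ₀) := CVal.fst τ
      let t : CVal Δ := CVal.fst τ'
      let t₀ : CVal Δ₀ := CVal.snd τ'
      let t₁ : CVal Δ₁ := CVal.snd τ
      d₀.den re σ w.1 (t.append t₀) * d₁.den re σ w.2 (t.append t₁)
  | _, _, _, _, .ctrl (Γ := Γ) (Δ := Δ) (T := T) (n := n) (Γp := Γp) _ _ d _ dp _ db, σ =>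
    Matrix.of fun w τ =>
      let s : CVal (Γ ++ Δ) := (CVal.fst σ).append (CVal.fst τ)
      ∑ v : T.Val, d.den re (outer s s) v v *
        ∑ j : Fin n, ∑ σj : CVal (Γp j),
          ((dp j).den re CVal.nil).conjTranspose σj v * (db j).den re (σ.append σj) w τ
  | _, _, _, _, .app df d, σ => df.den re * d.den re σ
  | _, _, _, _, .perm πg πd d, σ =>
    Matrix.of fun w τ => d.den re (πg.act.symm σ) w (πd.act.symm τ)

/-- `⟦Δ ⊩ e : T⟧`, for a proof of the judgment. -/
def MixExp.den (re : R → ℝ) : {Δ : Ctx X} → {e : Expr X R} → {T : Ty} →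
    MixExp Δ e T → SuperOp (CVal Δ) T.Val
  | _, _, _, .mix d => SuperOp.ofBasis fun τ τ' =>
    d.den re CVal.nil * outer τ τ' * (d.den re CVal.nil).conjTranspose
  | _, _, _, .perm π d => SuperOp.ofBasis fun τ τ' =>
    d.den re (outer (π.act.symm τ) (π.act.symm τ'))
  | _, _, _, .pair (Δ := Δ) (Δ₀ := Δ₀) (Δ₁ := Δ₁) _ d₀ d₁ => SuperOp.ofBasis fun τ τ' =>
    let t : CVal Δ := CVal.fst (CVal.fst (Γ := Δ ++ Δ₀) τ)
    let t₀ : CVal Δ₀ := CVal.snd (CVal.fst (Γ := Δ ++ Δ₀) τ)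
    let t₁ : CVal Δ₁ := CVal.snd τ
    let t' : CVal Δ := CVal.fst (CVal.fst (Γ := Δ ++ Δ₀) τ')
    let t₀' : CVal Δ₀ := CVal.snd (CVal.fst (Γ := Δ ++ Δ₀) τ')
    let t₁' : CVal Δ₁ := CVal.snd τ'
    tensorOp (d₀.den re (outer (t.append t₀) (t'.append t₀')))
      (d₁.den re (outer (t.append t₁) (t'.append t₁')))
  | _, _, _, .tryCatch (Δ₀ := Δ₀) (Δ₁ := Δ₁) _ d₀ d₁ => SuperOp.ofBasis fun τ τ' =>
    let t₀ : CVal Δ₀ := CVal.fst τ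
    let t₁ : CVal Δ₁ := CVal.snd τ
    let t₀' : CVal Δ₀ := CVal.fst τ'
    let t₁' : CVal Δ₁ := CVal.snd τ'
    d₀.den re (outer t₀ t₀') +
      (1 - (d₀.den re (outer t₀ t₀')).trace) • d₁.den re (outer t₁ t₁')
  | _, _, _, .app df d => (df.den re).comp (d.den re)

/-- `⟦⊢ f : T ⇝ T'⟧`, for a proof of the judgment. -/
def PureProg.den (re : R → ℝ) : {f : Prog X R} → {T T' : Ty} →
    PureProg f T T' → Op T.Val T'.Val
  | _, _, _, .gate rθ rφ rlam => gateOp (re rθ) (re rφ) (re rlam)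
  | _, _, _, .left T₀ T₁ => leftOp T₀ T₁
  | _, _, _, .right T₀ T₁ => rightOp T₀ T₁
  | _, _, _, .abs d d' => d'.den re CVal.nil * (d.den re CVal.nil).conjTranspose
  | _, _, _, .rphase r r' d =>
    Complex.exp (Complex.I * re r) • (d.den re CVal.nil * (d.den re CVal.nil).conjTranspose) +
      Complex.exp (Complex.I * re r') •
        (1 - d.den re CVal.nil * (d.den re CVal.nil).conjTranspose)

/-- `⟦⊢ f : T ⇛ T'⟧`, for a proof of the judgment. -/
def MixProg.den (re : R → ℝ) : {f : Prog X R} → {T T' : Ty} →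
    MixProg f T T' → SuperOp T.Val T'.Val
  | _, _, _, .channel d => SuperOp.ofBasis fun v v' =>
    d.den re * outer v v' * (d.den re).conjTranspose
  | _, _, _, .abs d d' => SuperOp.ofBasis fun v v' =>
    d'.den re (ptrace ((d.den re CVal.nil).conjTranspose * outer v v' * d.den re CVal.nil))

end

end Qunity

end

/-!
A judgment has many derivations for three reasons: contexts may be permuted at any point, a context is
split among the premises of a rule (and contexts for patterns are invented) without a trace in the
judgment, and pairing and application exist both as pure and as mixed rules. Uniqueness of the
denotation is obtained from a second semantics, `Expr.sem` and `Prog.sem`, defined by recursion on the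
syntax alone, to which the denotation of every derivation is equal (`PureExp.den_eq`, `MixExp.den_eq`,
`PureProg.den_eq`, `MixProg.den_eq`).

The second semantics evaluates a matrix entry `⟨w| ⟦e⟧_σ |τ⟩` in an environment, a function from all
variables to untyped values that extends both `σ` and `τ`. A variable denotes its value in the
environment, whether it is classical or quantum, and sharing a variable between the components of a
pair amounts to evaluating both in the same environment. Thus neither the order nor the splitting of
contexts plays any role.

A clause that sums over the valuations of a context hidden in the derivation (that of a pattern, or of
the left side of a `λ`) is expressed through the free variables `Expr.freeTy` of the expression at its
type. These determine that context up to order (`PureExp.freeTy_spec`, `MixExp.freeTy_iff`), types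
included, since quantum variables cannot be discarded and the syntax is annotated with all types that
are needed. The sum then runs over the environments obtained by rebinding these variables
(`finsum_variants`).

Finally, the mixed meaning of an expression that has a pure typing is conjugation by its pure meaning
(`PureExp.ker_eq`, `PureProg.ker_eq`), so that the place at which a derivation passes from pure to mixed
judgments does not matter.
-/

namespace Qunity

noncomputable section

universe u v

/-! ### Raw values, environments and free variables -/

/-- Values without their types. -/
inductive Raw : Type
  | unit : Raw
  | inl (a : Raw) : Raw
  | inr (a : Raw) : Raw
  | pair (a b : Raw) : Raw

/-- First component of a pair; every other raw value is left unchanged. -/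
def Raw.fst : Raw → Raw
  | .pair a _ => a
  | a => a

/-- Second component of a pair; every other raw value is left unchanged. -/
def Raw.snd : Raw → Raw
  | .pair _ b => b
  | a => a

/-- The first factor of a product type; every other type is left unchanged. -/
def Ty.fst : Ty → Ty
  | .prod T _ => T
  | T => T

/-- The second factor of a product type; every other type is left unchanged. -/
def Ty.snd : Ty → Ty
  | .prod _ T => T
  | T => T

/-- The raw value underlying a value of type `T`. -/
def Ty.raw : (T : Ty) → T.Val → Raw
  | .void, v => Empty.elim v
  | .unit, _ => .unit
  | .sum T₀ T₁, v => Sum.elim (fun a => .inl (T₀.raw a)) (fun a => .inr (T₁.raw a)) v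
  | .prod T₀ T₁, v => .pair (T₀.raw v.1) (T₁.raw v.2)

theorem Ty.raw_injective : (T : Ty) → Function.Injective T.raw
  | .void => fun v => Empty.elim v
  | .unit => fun _ _ _ => rfl
  | .sum T₀ T₁ => by
    rintro (a | a) (b | b) h
    · exact congrArg Sum.inl (T₀.raw_injective (Raw.inl.inj h))
    · exact absurd h Raw.noConfusion
    · exact absurd h Raw.noConfusion
    · exact congrArg Sum.inr (T₁.raw_injective (Raw.inr.inj h))
  | .prod T₀ T₁ => by
    intro v w h
    obtain ⟨h₀, h₁⟩ := Raw.pair.inj h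
    exact Prod.ext (T₀.raw_injective h₀) (T₁.raw_injective h₁)

/-- An environment assigns a raw value to every variable, be it classical or quantum. -/
abbrev Env (X : Type u) : Type u := X → Raw

variable {X : Type u} {R : Type v}

/-- `Agrees ρ σ`: the environment `ρ` assigns to every variable of `Γ` its value in `σ`. -/
def Agrees (ρ : Env X) : {Γ : Ctx X} → CVal Γ → Prop
  | [], _ => True
  | b :: _, σ => ρ b.1 = b.2.raw σ.1 ∧ Agrees ρ σ.2

open Classical in
/-- The environment that has the values of `σ` on the variables of `Γ` and those of `ρ` elsewhere. -/
def override (ρ : Env X) : {Γ : Ctx X} → CVal Γ → Env X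
  | [], _ => ρ
  | b :: _, σ => Function.update (override ρ σ.2) b.1 (b.2.raw σ.1)

/-- The environments that differ from `ρ` at most on the variables of `S`, where their values have
the types prescribed by `S`. -/
def variants (S : Set (X × Ty)) (ρ : Env X) : Set (Env X) :=
  {ρ' | (∀ x, (∀ T, (x, T) ∉ S) → ρ' x = ρ x) ∧ ∀ q ∈ S, ρ' q.1 ∈ Set.range q.2.raw}

/-- The input type of a program, which can be read off its annotations. -/
def Prog.src : Prog X R → Ty
  | .u3 _ _ _ => .bit
  | .left T _ => T
  | .right _ T => T
  | .abs _ T _ => T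
  | .rphase T _ _ _ => T

/-- The free variables of an expression of type `T`, each with the type that it has in every typing
of the expression. Unlike `Expr.FV`, this leaves out the pattern variables bound by `ctrl`. -/
def Expr.freeTy : Expr X R → Ty → Set (X × Ty)
  | .unit, _ => ∅
  | .var x, T => {(x, T)}
  | .pair e₀ e₁, T => e₀.freeTy T.fst ∪ e₁.freeTy T.snd
  | .ctrl e T _ p b T', _ =>
    e.freeTy T ∪ ⋃ j, {q | q ∈ (b j).freeTy T' ∧ ∀ S, (q.1, S) ∉ (p j).freeTy T}
  | .tryCatch e₀ e₁, T => e₀.freeTy T ∪ e₁.freeTy T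
  | .app f e, _ => e.freeTy f.src

/-! ### A semantics that does not mention derivations -/

/-- A pure and a mixed meaning, for inputs in `ι`: the amplitude `amp i w = ⟨w| A |i⟩` of an operator
`A` and the kernel `ker i i' w w' = ⟨w| F(|i⟩⟨i'|) |w'⟩` of a superoperator `F`. -/
structure Sem (ι : Type u) where
  amp : ι → Raw → ℂ
  ker : ι → ι → Raw → Raw → ℂ

/-- The kernel of the superoperator `ρ ↦ A ρ A†`. -/
def conjKer {ι : Type u} (a : ι → Raw → ℂ) (i i' : ι) (w w' : Raw) : ℂ := a i w * star (a i' w')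

/-- The meaning of a construct whose mixed denotation is induced by its pure one. -/
def Sem.ofAmp {ι : Type u} (a : ι → Raw → ℂ) : Sem ι := ⟨a, conjKer a⟩

/-- The amplitude `⟨w| u₃(θ, φ, λ) |v⟩` as a function of `v` and `w`, equal to `0` unless both are tagged. -/
def gateAmp (θ φ lam : ℝ) : Raw → Raw → ℂ
  | .inl _, .inl _ => (Real.cos (θ / 2) : ℂ)
  | .inl _, .inr _ => Complex.exp (Complex.I * φ) * Real.sin (θ / 2)
  | .inr _, .inl _ => -(Complex.exp (Complex.I * lam) * Real.sin (θ / 2))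
  | .inr _, .inr _ => Complex.exp (Complex.I * (φ + lam)) * Real.cos (θ / 2)
  | _, _ => 0

open Classical in
mutual

/-- The meaning of an expression of type `T`, as a function of the environment. Classical and quantum
variables are treated alike, and the sum over the valuations of a pattern context becomes a sum over
the environments that rebind the variables of the pattern. `try` has no pure typing, and its amplitude is
an arbitrary `0`. -/
def Expr.sem (re : R → ℝ) : Expr X R → Ty → Sem (Env X)
  | .unit, _ => .ofAmp fun _ _ => 1
  | .var x, _ => .ofAmp fun ρ w => if w = ρ x then 1 else 0
  | .pair e₀ e₁, T =>
    { amp := fun ρ w => (e₀.sem re T.fst).amp ρ w.fst * (e₁.sem re T.snd).amp ρ w.snd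
      ker := fun ρ ρ' w w' =>
        (e₀.sem re T.fst).ker ρ ρ' w.fst w'.fst * (e₁.sem re T.snd).ker ρ ρ' w.snd w'.snd }
  | .ctrl e T n p b T', _ => .ofAmp fun ρ w =>
    ∑ v : T.Val, (e.sem re T).ker ρ ρ (T.raw v) (T.raw v) *
      ∑ j : Fin n, ∑ᶠ ρ' ∈ variants ((p j).freeTy T) ρ,
        star (((p j).sem re T).amp ρ' (T.raw v)) * ((b j).sem re T').amp ρ' w
  | .tryCatch e₀ e₁, T =>
    { amp := fun _ _ => 0
      ker := fun ρ ρ' w w' =>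
        (e₀.sem re T).ker ρ ρ' w w' +
          (1 - ∑ v : T.Val, (e₀.sem re T).ker ρ ρ' (T.raw v) (T.raw v)) *
            (e₁.sem re T).ker ρ ρ' w w' }
  | .app f e, T =>
    { amp := fun ρ w => ∑ v : f.src.Val,
        (f.sem re T).amp ⟨f.src.raw v⟩ w * (e.sem re f.src).amp ρ (f.src.raw v)
      ker := fun ρ ρ' w w' => ∑ v : f.src.Val, ∑ v' : f.src.Val,
        (e.sem re f.src).ker ρ ρ' (f.src.raw v) (f.src.raw v') *
          (f.sem re T).ker ⟨f.src.raw v⟩ ⟨f.src.raw v'⟩ w w' }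

/-- The meaning of a program with target type `T'`. Programs are closed, so that the environments in
`λ` and `rphase` can be taken to vary around an arbitrary fixed one. `ULift` only serves to put the
results of the mutual recursion into a common universe. -/
def Prog.sem (re : R → ℝ) : Prog X R → Ty → Sem (ULift.{u} Raw)
  | .u3 rθ rφ rlam, _ => .ofAmp fun v => gateAmp (re rθ) (re rφ) (re rlam) v.down
  | .left _ _, _ => .ofAmp fun v w => if w = .inl v.down then 1 else 0
  | .right _ _, _ => .ofAmp fun v w => if w = .inr v.down then 1 else 0
  | .abs e T e', T' =>
    { amp := fun v w => ∑ᶠ ρ ∈ variants (e.freeTy T) fun _ => .unit,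
        (e'.sem re T').amp ρ w * star ((e.sem re T).amp ρ v.down)
      ker := fun v v' w w' => ∑ᶠ ρ ∈ variants (e.freeTy T) fun _ => .unit,
        ∑ᶠ ρ' ∈ variants (e'.freeTy T') ρ,
          star ((e.sem re T).amp ρ v.down) * (e.sem re T).amp ρ' v'.down * (e'.sem re T').ker ρ ρ' w w' }
  | .rphase T e r r', _ => .ofAmp fun v w =>
    let s := ∑ᶠ ρ ∈ variants (e.freeTy T) fun _ => .unit,
      (e.sem re T).amp ρ w * star ((e.sem re T).amp ρ v.down)
    Complex.exp (Complex.I * re r) * s +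
      Complex.exp (Complex.I * re r') * ((if w = v.down then 1 else 0) - s)

end

/-! ### Contexts and valuations -/

theorem mem_dom {Γ : Ctx X} {x : X} : x ∈ dom Γ ↔ ∃ T, (x, T) ∈ Γ := by
  simp [dom]

theorem CtxPerm.perm : {Γ Γ' : Ctx X} → CtxPerm Γ Γ' → Γ.Perm Γ'
  | _, _, .nil => .refl _
  | _, _, .cons b π => π.perm.cons b
  | _, _, .swap a b Γ => List.Perm.swap b a Γ
  | _, _, .trans π π' => π.perm.trans π'.perm

theorem WF.perm {Γ Γ' : Ctx X} (h : Γ.Perm Γ') (wf : WF Γ) : WF Γ' :=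
  (h.map Prod.fst).nodup wf

theorem WF.sublist {Γ Γ' : Ctx X} (h : Γ.Sublist Γ') (wf : WF Γ') : WF Γ :=
  List.Nodup.sublist (h.map Prod.fst) wf

theorem dom_append (Γ Δ : Ctx X) : dom (Γ ++ Δ) = dom Γ ++ dom Δ := List.map_append

theorem WF.notMem_right {Γ Δ : Ctx X} (wf : WF (Γ ++ Δ)) {q : X × Ty} (h : q ∈ Γ) (S : Ty) :
    (q.1, S) ∉ Δ := fun h' => by
  rw [WF, dom_append] at wf
  exact List.disjoint_of_nodup_append wf (mem_dom.2 ⟨q.2, h⟩) (mem_dom.2 ⟨S, h'⟩)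

theorem WF.notMem_left {Γ Δ : Ctx X} (wf : WF (Γ ++ Δ)) {q : X × Ty} (h : q ∈ Δ) (S : Ty) :
    (q.1, S) ∉ Γ := fun h' => by
  rw [WF, dom_append] at wf
  exact List.disjoint_of_nodup_append wf (mem_dom.2 ⟨S, h'⟩) (mem_dom.2 ⟨q.2, h⟩)

theorem agrees_append {ρ : Env X} : {Γ Δ : Ctx X} → (σ : CVal Γ) → (τ : CVal Δ) →
    (Agrees ρ (σ.append τ) ↔ Agrees ρ σ ∧ Agrees ρ τ)
  | [], _, _, _ => (iff_of_eq (true_and _)).symm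
  | _ :: _, _, σ, τ => (and_congr_right' (agrees_append σ.2 τ)).trans and_assoc.symm

theorem CVal.append_fst_snd : {Γ Δ : Ctx X} → (σ : CVal (Γ ++ Δ)) →
    CVal.append (CVal.fst σ) (CVal.snd σ) = σ
  | [], _, _ => rfl
  | _ :: _, _, σ => Prod.ext rfl (CVal.append_fst_snd σ.2)

theorem CVal.fst_append : {Γ Δ : Ctx X} → (σ : CVal Γ) → (τ : CVal Δ) →
    CVal.fst (CVal.append σ τ) = σ
  | [], _, _, _ => rfl
  | _ :: _, _, σ, τ => Prod.ext rfl (CVal.fst_append σ.2 τ)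

theorem CVal.snd_append : {Γ Δ : Ctx X} → (σ : CVal Γ) → (τ : CVal Δ) →
    CVal.snd (CVal.append σ τ) = τ
  | [], _, _, _ => rfl
  | _ :: _, _, σ, τ => CVal.snd_append σ.2 τ

/-- A valuation of `Γ, Δ` is a pair of valuations. -/
def CVal.appendEquiv (Γ Δ : Ctx X) : CVal Γ × CVal Δ ≃ CVal (Γ ++ Δ) where
  toFun p := p.1.append p.2
  invFun σ := (CVal.fst σ, CVal.snd σ)
  left_inv _ := Prod.ext (CVal.fst_append _ _) (CVal.snd_append _ _)
  right_inv σ := CVal.append_fst_snd σ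

theorem Agrees.fst {ρ : Env X} {Γ Δ : Ctx X} {σ : CVal (Γ ++ Δ)} (h : Agrees ρ σ) :
    Agrees ρ (CVal.fst σ) := by
  rw [← CVal.append_fst_snd σ, agrees_append] at h
  exact h.1

theorem Agrees.snd {ρ : Env X} {Γ Δ : Ctx X} {σ : CVal (Γ ++ Δ)} (h : Agrees ρ σ) :
    Agrees ρ (CVal.snd σ) := by
  rw [← CVal.append_fst_snd σ, agrees_append] at h
  exact h.2

theorem Agrees.append {ρ : Env X} {Γ Δ : Ctx X} {σ : CVal Γ} {τ : CVal Δ} (h : Agrees ρ σ)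
    (h' : Agrees ρ τ) : Agrees ρ (σ.append τ) := (agrees_append σ τ).2 ⟨h, h'⟩

theorem CtxPerm.agrees_act {ρ : Env X} : {Γ Γ' : Ctx X} → (π : CtxPerm Γ Γ') → (σ : CVal Γ) →
    (Agrees ρ (π.act σ) ↔ Agrees ρ σ)
  | _, _, .nil, _ => Iff.rfl
  | _, _, .cons _ π, σ => and_congr_right' (π.agrees_act σ.2)
  | _, _, .swap _ _ _, _ => and_left_comm
  | _, _, .trans π π', σ => (π'.agrees_act (π.act σ)).trans (π.agrees_act σ)

theorem Agrees.act_symm {ρ : Env X} {Γ Γ' : Ctx X} (π : CtxPerm Γ Γ') {σ : CVal Γ'}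
    (h : Agrees ρ σ) : Agrees ρ (π.act.symm σ) := by
  rwa [← π.agrees_act, Equiv.apply_symm_apply]

theorem Agrees.congr {ρ ρ' : Env X} : {Γ : Ctx X} → {σ : CVal Γ} → Agrees ρ σ →
    (∀ q ∈ Γ, ρ' q.1 = ρ q.1) → Agrees ρ' σ
  | [], _, _, _ => trivial
  | b :: _, _, h, e =>
    ⟨(e b List.mem_cons_self).trans h.1, h.2.congr fun q hq => e q (List.mem_cons_of_mem _ hq)⟩

theorem Agrees.unique {ρ : Env X} : {Γ : Ctx X} → {σ σ' : CVal Γ} → Agrees ρ σ → Agrees ρ σ' →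
    σ = σ'
  | [], _, _, _, _ => rfl
  | b :: _, _, _, h, h' =>
    Prod.ext (b.2.raw_injective (h.1.symm.trans h'.1)) (h.2.unique h'.2)

open Classical in
theorem override_of_notMem (ρ : Env X) : {Γ : Ctx X} → (σ : CVal Γ) → {x : X} →
    (∀ T, (x, T) ∉ Γ) → override ρ σ x = ρ x
  | [], _, _, _ => rfl
  | b :: Γ, σ, x, h => by
    have hx : x ≠ b.1 := fun e => h b.2 (e ▸ List.mem_cons_self)
    rw [override, Function.update_of_ne hx]
    exact override_of_notMem ρ σ.2 fun T hT => h T (List.mem_cons_of_mem _ hT)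

open Classical in
theorem agrees_override (ρ : Env X) : {Γ : Ctx X} → WF Γ → (σ : CVal Γ) →
    Agrees (override ρ σ) σ
  | [], _, _ => trivial
  | b :: Γ, wf, σ => by
    have wf' : b.1 ∉ dom Γ ∧ WF Γ := List.nodup_cons.1 wf
    refine ⟨Function.update_self .., (agrees_override ρ wf'.2 σ.2).congr fun q hq => ?_⟩
    refine Function.update_of_ne (fun e => wf'.1 ?_) _ _
    exact e ▸ mem_dom.2 ⟨q.2, hq⟩

theorem override_injective (ρ : Env X) {Γ : Ctx X} (wf : WF Γ) :
    Function.Injective fun σ : CVal Γ => override ρ σ := fun σ σ' h =>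
  (agrees_override ρ wf σ).unique ((congrArg (Agrees · σ') h).mpr (agrees_override ρ wf σ'))

theorem exists_agrees {ρ : Env X} : {Γ : Ctx X} → (∀ q ∈ Γ, ρ q.1 ∈ Set.range q.2.raw) →
    ∃ σ : CVal Γ, Agrees ρ σ
  | [], _ => ⟨(), trivial⟩
  | b :: _, h => by
    obtain ⟨v, hv⟩ := h b List.mem_cons_self
    obtain ⟨σ, hσ⟩ := exists_agrees fun q hq => h q (List.mem_cons_of_mem _ hq)
    exact ⟨(v, σ), hv.symm, hσ⟩

theorem Agrees.mem_range {ρ : Env X} : {Γ : Ctx X} → {σ : CVal Γ} → Agrees ρ σ →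
    ∀ q ∈ Γ, ρ q.1 ∈ Set.range q.2.raw
  | _ :: _, σ, h, _, hq => by
    rcases List.mem_cons.1 hq with rfl | hq
    · exact ⟨σ.1, h.1.symm⟩
    · exact h.2.mem_range _ hq

theorem Agrees.eq_override {ρ ρ' : Env X} {Γ : Ctx X} {σ : CVal Γ} (h : Agrees ρ' σ) (wf : WF Γ)
    (hρ : ∀ x, (∀ T, (x, T) ∉ Γ) → ρ' x = ρ x) : override ρ σ = ρ' := by
  funext x
  by_cases hx : ∃ T, (x, T) ∈ Γ
  · obtain ⟨T, hT⟩ := hx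
    have key : ∀ {Γ : Ctx X} {σ : CVal Γ} {ρ₁ ρ₂ : Env X}, Agrees ρ₁ σ → Agrees ρ₂ σ →
        ∀ q ∈ Γ, ρ₁ q.1 = ρ₂ q.1 := by
      intro Γ
      induction Γ with
      | nil => simp
      | cons b Γ ih =>
        intro σ ρ₁ ρ₂ h₁ h₂ q hq
        rcases List.mem_cons.1 hq with rfl | hq
        · exact h₁.1.trans h₂.1.symm
        · exact ih h₁.2 h₂.2 q hq
    exact key (agrees_override ρ wf σ) h (x, T) hT
  · push Not at hx
    rw [override_of_notMem ρ σ hx, hρ x hx]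

/-- The variants of `ρ` on the variables of a context are parametrized by its valuations. -/
theorem range_override {S : Set (X × Ty)} {Γ : Ctx X} (wf : WF Γ) (hS : ∀ q, q ∈ Γ ↔ q ∈ S)
    (ρ : Env X) : Set.range (fun σ : CVal Γ => override ρ σ) = variants S ρ := by
  obtain rfl : S = {q | q ∈ Γ} := Set.ext fun q => (hS q).symm
  ext ρ'
  constructor
  · rintro ⟨σ, rfl⟩
    exact ⟨fun x hx => override_of_notMem ρ σ hx, (agrees_override ρ wf σ).mem_range⟩
  · rintro ⟨h, h'⟩
    obtain ⟨σ, hσ⟩ := exists_agrees h'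
    exact ⟨σ, hσ.eq_override wf h⟩

/-- A sum over the variants of an environment is a sum over valuations. This does not depend on the
order in which a context lists its variables. -/
theorem finsum_variants {S : Set (X × Ty)} {Γ : Ctx X} (wf : WF Γ) (hS : ∀ q, q ∈ Γ ↔ q ∈ S)
    (ρ : Env X) (g : Env X → ℂ) :
    ∑ᶠ ρ' ∈ variants S ρ, g ρ' = ∑ σ : CVal Γ, g (override ρ σ) := by
  rw [← range_override wf hS, finsum_mem_range (override_injective ρ wf), finsum_eq_sum_of_fintype]

/-! ### Free variables of typed expressions -/

theorem PureProg.src_eq {f : Prog X R} {T T' : Ty} (d : PureProg f T T') : f.src = T := by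
  cases d <;> rfl

theorem MixProg.src_eq {f : Prog X R} {T T' : Ty} : MixProg f T T' → f.src = T
  | .channel d => d.src_eq
  | .abs _ _ => rfl

mutual

/-- The contexts of a derivable pure judgment are well-formed and disjoint: the premises written into the
rules suffice. -/
theorem PureExp.wf : {Γ Δ : Ctx X} → {e : Expr X R} → {T : Ty} → PureExp Γ Δ e T → WF (Γ ++ Δ)
  | _, _, _, _, .unit wf => by rwa [List.append_nil]
  | _, _, _, _, .cvar wf => by rwa [List.append_nil]
  | Γ, _, _, _, .qvar (x := x) (T := T) wf hx => WF.perm (List.perm_append_comm (l₁ := [(x, T)]))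
      (List.nodup_cons.2 ⟨hx, wf⟩ : WF ((x, T) :: Γ))
  | Γ, _, _, _, .pair (Δ := Δ) (Δ₀ := Δ₀) (Δ₁ := Δ₁) wf d₀ d₁ => by
    have h₀ := d₀.wf
    have h₁ := d₁.wf
    simp only [WF, dom_append, List.nodup_append'] at *
    simp only [List.disjoint_append_right] at *
    tauto
  | _, _, _, _, .ctrl wf _ _ _ _ _ _ => wf
  | _, _, _, _, .app _ d => d.wf
  | _, _, _, _, .perm πg πd d => d.wf.perm (πg.perm.append πd.perm)

theorem MixExp.wf : {Δ : Ctx X} → {e : Expr X R} → {T : Ty} → MixExp Δ e T → WF Δ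
  | _, _, _, .mix d => d.wf
  | _, _, _, .perm π d => d.wf.perm π.perm
  | _, _, _, .pair wf _ _ => wf
  | _, _, _, .tryCatch wf _ _ => wf
  | _, _, _, .app _ d => d.wf

end

mutual

/-- Quantum variables have to be used and classical ones may be discarded. In the `ctrl` rule, a variable
of `Δ'` is used by the first branch when there is one, while `Δ'` is empty otherwise. -/
theorem PureExp.freeTy_spec : {Γ Δ : Ctx X} → {e : Expr X R} → {T : Ty} → PureExp Γ Δ e T →
    (∀ q ∈ Δ, q ∈ e.freeTy T) ∧ ∀ q ∈ e.freeTy T, q ∈ Γ ∨ q ∈ Δ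
  | _, _, _, _, .unit _ => by simp [Expr.freeTy]
  | _, _, _, _, .cvar _ => by simp [Expr.freeTy]
  | _, _, _, _, .qvar _ _ => by simp [Expr.freeTy]
  | _, _, _, _, .pair _ d₀ d₁ => by
    have h₀ := d₀.freeTy_spec
    have h₁ := d₁.freeTy_spec
    simp only [Expr.freeTy, Ty.fst, Ty.snd, List.mem_append, Set.mem_union] at *
    grind
  | _, _, _, _, .ctrl (Γ := Γ) (Γ' := Γ') (Δ := Δ) (Δ' := Δ') (n := n) (p := p) (Γp := Γp)
      _ relevant d _ dp _ db => by
    have h := d.freeTy_iff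
    have hb := fun j => (db j).freeTy_spec
    have hp : ∀ j q, q ∈ (p j).freeTy _ ↔ q ∈ Γp j := fun j q =>
      ⟨fun hq => ((dp j).freeTy_spec.2 q hq).resolve_left List.not_mem_nil,
        (dp j).freeTy_spec.1 q⟩
    simp only [Expr.freeTy, Set.mem_union, Set.mem_iUnion, Set.mem_ofPred_eq, hp, ← h]
    constructor
    · intro q hq
      rcases Nat.eq_zero_or_pos n with rfl | hn
      · rw [relevant rfl, List.append_nil] at hq
        exact .inl (List.mem_append_right _ hq)
      · refine .inr ⟨⟨0, hn⟩, (hb _).1 q hq, fun S hS => ?_⟩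
        exact (db ⟨0, hn⟩).wf.notMem_left hq S (List.mem_append_right _ hS)
    · rintro q (hq | ⟨j, hq, hj⟩)
      · simp only [List.mem_append] at hq ⊢
        tauto
      · have := (hb j).2 q hq
        have hj := hj q.2
        simp only [List.mem_append] at this ⊢
        tauto
  | _, _, _, _, .app df d => by
    have h := d.freeTy_spec
    rwa [← df.src_eq] at h
  | _, _, _, _, .perm πg πd d => by
    have h := d.freeTy_spec
    simpa only [πg.perm.mem_iff, πd.perm.mem_iff] using h

/-- The quantum context of a mixed judgment, with its types, is determined up to order by the expression
and its type. -/
theorem MixExp.freeTy_iff : {Δ : Ctx X} → {e : Expr X R} → {T : Ty} → MixExp Δ e T →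
    ∀ q, q ∈ Δ ↔ q ∈ e.freeTy T
  | _, _, _, .mix d, q =>
    ⟨d.freeTy_spec.1 q, fun hq => (d.freeTy_spec.2 q hq).resolve_left List.not_mem_nil⟩
  | _, _, _, .perm π d, q => π.perm.mem_iff.symm.trans (d.freeTy_iff q)
  | _, _, _, .pair _ d₀ d₁, q => by
    have h₀ := d₀.freeTy_iff q
    have h₁ := d₁.freeTy_iff q
    simp only [Expr.freeTy, Ty.fst, Ty.snd, List.mem_append, Set.mem_union] at *
    tauto
  | _, _, _, .tryCatch _ d₀ d₁, q => by
    rw [Expr.freeTy, Set.mem_union, ← d₀.freeTy_iff, ← d₁.freeTy_iff, List.mem_append]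
  | _, _, _, .app df d, q => by
    have h := d.freeTy_iff q
    rwa [← df.src_eq] at h

end

theorem PureExp.freeTy_iff {Δ : Ctx X} {e : Expr X R} {T : Ty} (d : PureExp [] Δ e T) :
    ∀ q, q ∈ Δ ↔ q ∈ e.freeTy T := (MixExp.mix d).freeTy_iff

/-! ### Superoperators on basis elements -/

theorem SuperOp.ofBasis_outer {m n : Type} [Fintype m] [DecidableEq m] (F : m → m → Op n n)
    (i j : m) : SuperOp.ofBasis F (outer i j) = F i j := by
  change ∑ i', ∑ j', outer i j i' j' • F i' j' = F i j
  rw [Finset.sum_eq_single i, Finset.sum_eq_single j]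
  · simp [outer]
  · intro j' _ h
    simp [outer, h.symm]
  · simp
  · intro i' _ h
    simp [outer, h.symm]
  · simp

theorem SuperOp.apply_eq_sum {m n : Type} [Fintype m] [DecidableEq m] (L : SuperOp m n)
    (ρ : Op m m) (w w' : n) : L ρ w w' = ∑ i, ∑ j, ρ i j * L (outer i j) w w' := by
  have h : ρ = ∑ i, ∑ j, ρ i j • outer i j := by
    refine (Matrix.matrix_eq_sum_single ρ).trans ?_
    simp only [outer, Matrix.smul_single, smul_eq_mul, mul_one]
  have h' : L ρ = ∑ i, ∑ j, ρ i j • L (outer i j) := by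
    conv_lhs => rw [h]
    simp only [map_sum, map_smul]
  rw [h', Matrix.sum_apply]
  refine Finset.sum_congr rfl fun i _ => ?_
  rw [Matrix.sum_apply]
  rfl

/-- A superoperator is determined by its values on the operators `|i⟩⟨j|`. -/
theorem SuperOp.ext_outer {m n : Type} [Fintype m] [DecidableEq m] {L L' : SuperOp m n}
    (h : ∀ i j w w', L (outer i j) w w' = L' (outer i j) w w') : L = L' := by
  refine LinearMap.ext fun ρ => Matrix.ext fun w w' => ?_
  rw [L.apply_eq_sum ρ w w', L'.apply_eq_sum ρ w w']
  simp only [h]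

theorem mul_outer_mul_apply {m n k : Type} [Fintype m] [DecidableEq m]
    (A : Matrix n m ℂ) (B : Matrix m k ℂ) (i j : m) (w : n) (w' : k) :
    (A * outer i j * B) w w' = A w i * B j w' := by
  rw [Matrix.mul_apply, Finset.sum_eq_single j]
  · simp [outer]
  · intro j' _ h
    simp [outer, Matrix.mul_single_apply_of_ne, h]
  · simp

theorem ptrace_apply {Δ Δ₀ : Ctx X} (ρ : Op (CVal (Δ ++ Δ₀)) (CVal (Δ ++ Δ₀))) (τ τ' : CVal Δ) :
    ptrace ρ τ τ' = ∑ τ₀ : CVal Δ₀, ρ (τ.append τ₀) (τ'.append τ₀) := rfl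

/-! ### On pure terms the mixed semantics is conjugation by the pure one -/

theorem override_override (ρ : Env X) {Γ : Ctx X} (wf : WF Γ) (σ σ' : CVal Γ) :
    override (override ρ σ) σ' = override ρ σ' :=
  (agrees_override ρ wf σ').eq_override wf fun x hx => by
    rw [override_of_notMem ρ σ' hx, override_of_notMem ρ σ hx]

mutual

/-- The rules for pairs and applications exist both as pure and as mixed rules, and a pure judgment can
be turned into a mixed one at any point of a derivation; this lemma makes the choice immaterial. -/
theorem PureExp.ker_eq (re : R → ℝ) : {Γ Δ : Ctx X} → {e : Expr X R} → {T : Ty} →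
    PureExp Γ Δ e T → (e.sem re T).ker = conjKer (e.sem re T).amp
  | _, _, _, _, .unit _ => by rw [Expr.sem]; rfl
  | _, _, _, _, .cvar _ => by rw [Expr.sem]; rfl
  | _, _, _, _, .qvar _ _ => by rw [Expr.sem]; rfl
  | _, _, _, _, .pair _ d₀ d₁ => by
    have h₀ := d₀.ker_eq re
    have h₁ := d₁.ker_eq re
    rw [Expr.sem]
    funext ρ ρ' w w'
    simp only [Ty.fst, Ty.snd, h₀, h₁, conjKer, star_mul']
    ring
  | _, _, _, _, .ctrl _ _ _ _ _ _ _ => by rw [Expr.sem]; rfl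
  | _, _, _, _, .app df d => by
    have h := d.ker_eq re
    have hf := df.ker_eq re
    rw [← df.src_eq] at h
    rw [Expr.sem]
    funext ρ ρ' w w'
    simp only [h, hf, conjKer, star_sum, star_mul', Finset.sum_mul_sum]
    refine Finset.sum_congr rfl fun v _ => Finset.sum_congr rfl fun v' _ => ?_
    ring
  | _, _, _, _, .perm _ _ d => d.ker_eq re

/-- For `λ`, a pure typing makes the two expressions use the same variables, so that the partial trace
in the mixed meaning is vacuous and the kernel factors. -/
theorem PureProg.ker_eq (re : R → ℝ) : {f : Prog X R} → {T T' : Ty} →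
    PureProg f T T' → (f.sem re T').ker = conjKer (f.sem re T').amp
  | _, _, _, .gate _ _ _ => by rw [Prog.sem]; rfl
  | _, _, _, .left _ _ => by rw [Prog.sem]; rfl
  | _, _, _, .right _ _ => by rw [Prog.sem]; rfl
  | _, _, _, .abs d d' => by
    have h' := d'.ker_eq re
    rw [Prog.sem]
    funext v v' w w'
    simp only [finsum_variants d.wf d.freeTy_iff, finsum_variants d'.wf d'.freeTy_iff, h', conjKer,
      override_override _ d.wf, star_sum, star_mul', star_star, Finset.sum_mul_sum]
    refine Finset.sum_congr rfl fun σ _ => Finset.sum_congr rfl fun σ' _ => ?_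
    ring
  | _, _, _, .rphase _ _ _ => by rw [Prog.sem]; rfl

end

/-! ### The denotation of a derivation is the derivation-free semantics -/

mutual

/-- The matrix entry at `(w, τ)` depends on the derivation only through the judgment, as its value can be
read off any environment that extends `σ` and `τ`. -/
theorem PureExp.den_eq (re : R → ℝ) : {Γ Δ : Ctx X} → {e : Expr X R} → {T : Ty} →
    (P : PureExp Γ Δ e T) → ∀ {ρ : Env X} {σ : CVal Γ} {τ : CVal Δ}, Agrees ρ σ → Agrees ρ τ →
      ∀ w, P.den re σ w τ = (e.sem re T).amp ρ (T.raw w)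
  | _, _, _, _, .unit _, ρ, σ, τ, _, _, w => by rw [PureExp.den, Expr.sem]; rfl
  | _, _, _, _, .cvar (T := T) _, ρ, σ, τ, hσ, _, w => by
    rw [PureExp.den, Expr.sem]
    simp only [Sem.ofAmp, Matrix.of_apply, hσ.snd.1, T.raw_injective.eq_iff]
  | _, _, _, _, .qvar (T := T) _ _, ρ, σ, τ, _, hτ, w => by
    rw [PureExp.den, Expr.sem]
    simp only [Sem.ofAmp, Matrix.of_apply, hτ.1, T.raw_injective.eq_iff]
  | _, _, _, _, .pair _ d₀ d₁, ρ, σ, τ, hσ, hτ, w => by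
    rw [PureExp.den, Expr.sem, Matrix.of_apply]
    exact congrArg₂ (· * ·) (d₀.den_eq re hσ (hτ.fst.fst.append hτ.fst.snd) _)
      (d₁.den_eq re hσ (hτ.fst.fst.append hτ.snd) _)
  | _, _, _, _, .ctrl wf _ d _ dp _ db, ρ, σ, τ, hσ, hτ, w => by
    rw [PureExp.den, Expr.sem, Matrix.of_apply]
    refine Finset.sum_congr rfl fun v _ => ?_
    have hs := hσ.fst.append hτ.fst
    refine congrArg₂ (· * ·) (d.den_eq re hs hs v v) (Finset.sum_congr rfl fun j _ => ?_)
    rw [finsum_variants (dp j).wf (dp j).freeTy_iff]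
    refine Finset.sum_congr rfl fun σj _ => ?_
    have hj := agrees_override ρ (dp j).wf σj
    have wfb := (db j).wf
    -- Rebinding the pattern variables affects neither the classical nor the quantum context.
    have hσ' := hσ.congr fun q hq => override_of_notMem ρ σj
      (WF.notMem_right (WF.sublist (List.sublist_append_left _ _) wfb) hq)
    have hτ' := hτ.congr fun q hq => override_of_notMem ρ σj
      fun S hS => wfb.notMem_left hq S (List.mem_append_right _ hS)
    rw [Matrix.conjTranspose_apply, (dp j).den_eq re (ρ := override ρ σj) trivial hj v,
      (db j).den_eq re (hσ'.append hj) hτ' w]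
  | _, _, _, _, .app df d, ρ, σ, τ, hσ, hτ, w => by
    have h := d.den_eq re hσ hτ
    have hf := df.den_eq re
    obtain rfl := df.src_eq
    rw [PureExp.den, Expr.sem, Matrix.mul_apply]
    simp only [h, hf]
  | _, _, _, _, .perm πg πd d, ρ, σ, τ, hσ, hτ, w => by
    rw [PureExp.den]
    exact d.den_eq re (hσ.act_symm πg) (hτ.act_symm πd) w

/-- The two environments provide the row and the column of the argument `|τ⟩⟨τ'|`. -/
theorem MixExp.den_eq (re : R → ℝ) : {Δ : Ctx X} → {e : Expr X R} → {T : Ty} →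
    (P : MixExp Δ e T) → ∀ {ρ ρ' : Env X} {τ τ' : CVal Δ}, Agrees ρ τ → Agrees ρ' τ' →
      ∀ w w', P.den re (outer τ τ') w w' = (e.sem re T).ker ρ ρ' (T.raw w) (T.raw w')
  | _, _, _, .mix d, ρ, ρ', τ, τ', hτ, hτ', w, w' => by
    rw [MixExp.den, SuperOp.ofBasis_outer, mul_outer_mul_apply, Matrix.conjTranspose_apply,
      d.den_eq re (ρ := ρ) trivial hτ, d.den_eq re (ρ := ρ') trivial hτ', d.ker_eq re, conjKer]
  | _, _, _, .perm π d, ρ, ρ', τ, τ', hτ, hτ', w, w' => by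
    rw [MixExp.den, SuperOp.ofBasis_outer]
    exact d.den_eq re (hτ.act_symm π) (hτ'.act_symm π) w w'
  | _, _, _, .pair _ d₀ d₁, ρ, ρ', τ, τ', hτ, hτ', w, w' => by
    rw [MixExp.den, SuperOp.ofBasis_outer, Expr.sem]
    exact congrArg₂ (· * ·)
      (d₀.den_eq re (hτ.fst.fst.append hτ.fst.snd) (hτ'.fst.fst.append hτ'.fst.snd) _ _)
      (d₁.den_eq re (hτ.fst.fst.append hτ.snd) (hτ'.fst.fst.append hτ'.snd) _ _)
  | _, _, _, .tryCatch _ d₀ d₁, ρ, ρ', τ, τ', hτ, hτ', w, w' => by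
    have h₀ := d₀.den_eq re hτ.fst hτ'.fst
    have h₁ := d₁.den_eq re hτ.snd hτ'.snd
    rw [MixExp.den, SuperOp.ofBasis_outer, Expr.sem]
    simp only [Matrix.add_apply, Matrix.smul_apply, smul_eq_mul, Matrix.trace, Matrix.diag, h₀, h₁]
  | _, _, _, .app df d, ρ, ρ', τ, τ', hτ, hτ', w, w' => by
    have h := d.den_eq re hτ hτ'
    have hf := df.den_eq re
    obtain rfl := df.src_eq
    rw [MixExp.den, LinearMap.comp_apply, SuperOp.apply_eq_sum, Expr.sem]
    simp only [h, hf]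

theorem PureProg.den_eq (re : R → ℝ) : {f : Prog X R} → {T T' : Ty} → (P : PureProg f T T') →
    ∀ v w, P.den re w v = (f.sem re T').amp ⟨T.raw v⟩ (T'.raw w)
  | _, _, _, .gate _ _ _, v, w => by
    rw [PureProg.den, Prog.sem]
    rcases v with v | v <;> rcases w with w | w <;> rfl
  | _, _, _, .left T₀ T₁, v, w => by
    rw [PureProg.den, Prog.sem]
    have h := (T₀.sum T₁).raw_injective.eq_iff (a := w) (b := Sum.inl v)
    exact @if_congr _ _ _ (_) (_) _ _ _ _ h.symm rfl rfl
  | _, _, _, .right T₀ T₁, v, w => by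
    rw [PureProg.den, Prog.sem]
    have h := (T₀.sum T₁).raw_injective.eq_iff (a := w) (b := Sum.inr v)
    exact @if_congr _ _ _ (_) (_) _ _ _ _ h.symm rfl rfl
  | _, _, _, .abs d d', v, w => by
    rw [PureProg.den, Prog.sem, Matrix.mul_apply]
    simp only [finsum_variants d.wf d.freeTy_iff, Matrix.conjTranspose_apply]
    refine Finset.sum_congr rfl fun τ _ => ?_
    have hτ := agrees_override (fun _ => .unit) d.wf τ
    rw [d.den_eq re (ρ := override _ τ) trivial hτ, d'.den_eq re (ρ := override _ τ) trivial hτ]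
  | _, _, _, .rphase (e := e) (T := T) _ _ d, v, w => by
    have h : ∀ w v, (d.den re CVal.nil * (d.den re CVal.nil).conjTranspose) w v =
        ∑ᶠ ρ ∈ variants (e.freeTy T) fun _ => .unit,
          (e.sem re T).amp ρ (T.raw w) * star ((e.sem re T).amp ρ (T.raw v)) := fun w v => by
      rw [finsum_variants d.wf d.freeTy_iff, Matrix.mul_apply]
      refine Finset.sum_congr rfl fun τ _ => ?_
      have hτ := agrees_override (fun _ => .unit) d.wf τ
      rw [Matrix.conjTranspose_apply, d.den_eq re (ρ := override _ τ) trivial hτ,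
        d.den_eq re (ρ := override _ τ) trivial hτ]
    rw [PureProg.den, Prog.sem]
    simp only [Sem.ofAmp, Matrix.add_apply, Matrix.smul_apply, Matrix.sub_apply, Matrix.one_apply,
      smul_eq_mul, h, T.raw_injective.eq_iff]

theorem MixProg.den_eq (re : R → ℝ) : {f : Prog X R} → {T T' : Ty} → (P : MixProg f T T') →
    ∀ v v' w w', P.den re (outer v v') w w' =
      (f.sem re T').ker ⟨T.raw v⟩ ⟨T.raw v'⟩ (T'.raw w) (T'.raw w')
  | _, _, _, .channel d, v, v', w, w' => by
    rw [MixProg.den, SuperOp.ofBasis_outer, mul_outer_mul_apply, Matrix.conjTranspose_apply,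
      d.den_eq re, d.den_eq re, d.ker_eq re, conjKer]
  | _, _, _, .abs (Δ := Δ) (Δ₀ := Δ₀) d d', v, v', w, w' => by
    rw [MixProg.den, SuperOp.ofBasis_outer, SuperOp.apply_eq_sum, Prog.sem]
    simp only [finsum_variants d.wf d.freeTy_iff, finsum_variants d'.wf d'.freeTy_iff, ptrace_apply,
      mul_outer_mul_apply, Matrix.conjTranspose_apply, Finset.sum_mul]
    refine .trans (Finset.sum_congr rfl fun τ _ => ?_)
      ((Fintype.sum_prod_type _).symm.trans ((CVal.appendEquiv Δ Δ₀).sum_comp _))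
    refine Finset.sum_comm.trans ?_
    refine Finset.sum_congr rfl fun τ₀ _ => Finset.sum_congr rfl fun τ' _ => ?_
    have hτ := agrees_override (fun _ => .unit) d.wf (τ.append τ₀)
    have hτ' := agrees_override (override (fun _ => .unit) (τ.append τ₀)) d'.wf τ'
    -- Varying the valuation of `Δ` leaves the traced-out part `τ₀` as it is.
    have hτ₀ := ((agrees_append τ τ₀).1 hτ).2.congr fun q hq =>
      override_of_notMem (override (fun _ => .unit) (τ.append τ₀)) τ'
        (WF.notMem_left (Γ := Δ) (Δ := Δ₀) d.wf hq)
    rw [d'.den_eq re ((agrees_append τ τ₀).1 hτ).1 hτ',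
      d.den_eq re (ρ := override _ (τ.append τ₀)) trivial hτ,
      d.den_eq re (ρ := override (override _ (τ.append τ₀)) τ') trivial (hτ'.append hτ₀)]
    rfl

end

theorem PureExp.den_unique (re : R → ℝ) {Γ Δ : Ctx X} {e : Expr X R} {T : Ty} (σ : CVal Γ)
    (P P' : PureExp Γ Δ e T) : P.den re σ = P'.den re σ := by
  ext w τ
  have h := agrees_override (fun _ => .unit) P.wf (σ.append τ)
  rw [agrees_append] at h
  rw [P.den_eq re h.1 h.2, P'.den_eq re h.1 h.2]

theorem MixExp.den_unique (re : R → ℝ) {Δ : Ctx X} {e : Expr X R} {T : Ty}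
    (P P' : MixExp Δ e T) : P.den re = P'.den re :=
  SuperOp.ext_outer fun τ τ' w w' => by
    have h := agrees_override (fun _ => .unit) P.wf τ
    have h' := agrees_override (fun _ => .unit) P.wf τ'
    rw [P.den_eq re h h', P'.den_eq re h h']

theorem PureProg.den_unique (re : R → ℝ) {f : Prog X R} {T T' : Ty}
    (P P' : PureProg f T T') : P.den re = P'.den re := by
  ext w v
  rw [P.den_eq, P'.den_eq]

theorem MixProg.den_unique (re : R → ℝ) {f : Prog X R} {T T' : Ty}
    (P P' : MixProg f T T') : P.den re = P'.den re :=
  SuperOp.ext_outer fun v v' w w' => by rw [P.den_eq, P'.den_eq]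

theorem existsUnique_forall_eq {α β : Type*} (h : Nonempty α) {g : α → β}
    (hg : ∀ a a', g a = g a') : ∃! b, ∀ a, g a = b :=
  h.elim fun a => ⟨g a, fun a' => hg a' a, fun _ hb => (hb a).symm⟩

end

end Qunity

/-- Qunity has a well-defined semantics: every valid typing judgment has exactly one denotation,
namely the common denotation of all of its proofs. -/
theorem mainTheorem1 {X : Type*} {R : Type*} (re : R → ℝ) :
    (∀ (Γ Δ : Qunity.Ctx X) (e : Qunity.Expr X R) (T : Qunity.Ty) (σ : Qunity.CVal Γ),
      Nonempty (Qunity.PureExp Γ Δ e T) →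
        ∃! L : Qunity.Op (Qunity.CVal Δ) T.Val,
          ∀ P : Qunity.PureExp Γ Δ e T, P.den re σ = L) ∧
    (∀ (Δ : Qunity.Ctx X) (e : Qunity.Expr X R) (T : Qunity.Ty),
      Nonempty (Qunity.MixExp Δ e T) →
        ∃! L : Qunity.SuperOp (Qunity.CVal Δ) T.Val,
          ∀ P : Qunity.MixExp Δ e T, P.den re = L) ∧
    (∀ (f : Qunity.Prog X R) (T T' : Qunity.Ty),
      Nonempty (Qunity.PureProg f T T') →
        ∃! L : Qunity.Op T.Val T'.Val,
          ∀ P : Qunity.PureProg f T T', P.den re = L) ∧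
    (∀ (f : Qunity.Prog X R) (T T' : Qunity.Ty),
      Nonempty (Qunity.MixProg f T T') →
        ∃! L : Qunity.SuperOp T.Val T'.Val,
          ∀ P : Qunity.MixProg f T T', P.den re = L) :=
  ⟨fun _ _ _ _ σ h => Qunity.existsUnique_forall_eq h (Qunity.PureExp.den_unique re σ),
    fun _ _ _ h => Qunity.existsUnique_forall_eq h (Qunity.MixExp.den_unique re),
    fun _ _ _ h => Qunity.existsUnique_forall_eq h (Qunity.PureProg.den_unique re),
    fun _ _ _ h => Qunity.existsUnique_forall_eq h (Qunity.MixProg.den_unique re)⟩
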